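/- Let $\Sigma$ be a smooth three-manifold, let $\mathfrak{e}=(e_u,e_l,e_n)$ be a global smooth coframe on $\Sigma$ (three smooth one-forms that are linearly independent at every point), and let $\Theta$ be a smooth symmetric covariant two-tensor on $\Sigma$. Let $$h = e_u\otimes e_u + e_l\otimes e_l + e_n\otimes e_n$$ be the Riemannian metric for which $\mathfrak{e}$ is orthonormal, and let $\nabla^h$ be its Levi-Civita connection. For a one-form $\alpha$ put $\Theta(\alpha) := \Theta(\alpha^{\sharp_h},\cdot)$; write $(\nabla^h\alpha)(X,Y)=(\nabla^h_X\alpha)(Y)$, $(\alpha\otimes\beta)(X,Y)=\alpha(X)\beta(Y)$ and $\alpha\wedge\beta=\alpha\otimes\beta-\beta\otimes\alpha$. Then the constraint equations $$\nabla^h e_u + \Theta = \Theta(e_u)\otimes e_u ,\qquad \nabla^h e_l = \Theta(e_l)\otimes e_u ,\qquad [\Theta(e_u)] = 0 \in H^1(\Sigma,\mathbb{R})$$ hold if and only if the exterior differential system $$\mathrm{d} e_u = \Theta(e_u)\wedge e_u ,\qquad \mathrm{d} e_l = \Theta(e_l)\wedge e_u ,\qquad \mathrm{d} e_n = \Theta(e_n)\wedge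 e_u ,\qquad [\Theta(e_u)] = 0 \in H^1(\Sigma,\mathbb{R})$$ holds. Here $[\Theta(e_u)]=0$ means that $\Theta(e_u)$ is closed and its de Rham class vanishes. -/

import Mathlib

open scoped Manifold ContDiff

noncomputable section

namespace CauchyGeometry

section General

variable {E : Type*} [NormedAddCommGroup E] [NormedSpace ℝ E] {H : Type*} [TopologicalSpace H]
  (I : ModelWithCorners ℝ E H) (M : Type*) [TopologicalSpace M] [ChartedSpace H M]
  [IsManifold I ∞ M]

/-- Smooth one-forms: smooth sections of the cotangent bundle. -/
abbrev OneForm := Cₛ^∞⟮I; E →L[ℝ] ℝ, fun x : M ↦ TangentSpace I x →L[ℝ] ℝ⟯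

/-- Smooth covariant two-tensors: smooth sections of the bundle of bilinear forms on the tangent
bundle. -/
abbrev TwoTensor := Cₛ^∞⟮I; E →L[ℝ] E →L[ℝ] ℝ,
  fun x : M ↦ TangentSpace I x →L[ℝ] TangentSpace I x →L[ℝ] ℝ⟯

/-- Smooth Riemannian metrics on the manifold. -/
abbrev Metric := Bundle.ContMDiffRiemannianMetric I ∞ E (fun x : M ↦ TangentSpace I x)

variable {I M}

/-- The tensor product of covectors, `(α ⊗ β) (v, w) = α v * β w`. -/
def tensor {x : M} (α β : TangentSpace I x →L[ℝ] ℝ) :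
    TangentSpace I x →L[ℝ] TangentSpace I x →L[ℝ] ℝ :=
  α.smulRight β

/-- The wedge product of covectors, `α ∧ β = α ⊗ β - β ⊗ α`. -/
def wedge {x : M} (α β : TangentSpace I x →L[ℝ] ℝ) :
    TangentSpace I x →L[ℝ] TangentSpace I x →L[ℝ] ℝ :=
  tensor α β - tensor β α

/-! ### Auxiliary facts on smooth sections -/

theorem trivializationAt_oneForm (x₀ x : M) (A : TangentSpace I x →L[ℝ] ℝ) (v : E) :
    (trivializationAt (E →L[ℝ] ℝ) (fun x : M ↦ TangentSpace I x →L[ℝ] ℝ) x₀ ⟨x, A⟩).2 v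
      = A ((trivializationAt E (TangentSpace I) x₀).symmL ℝ x v) := by
  simp [hom_trivializationAt_apply, ContinuousLinearMap.inCoordinates]

theorem trivializationAt_twoTensor (x₀ x : M)
    (hx : x ∈ (trivializationAt E (TangentSpace I) x₀).baseSet)
    (A : TangentSpace I x →L[ℝ] TangentSpace I x →L[ℝ] ℝ) (v w : E) :
    (trivializationAt (E →L[ℝ] E →L[ℝ] ℝ)
      (fun x : M ↦ TangentSpace I x →L[ℝ] TangentSpace I x →L[ℝ] ℝ) x₀ ⟨x, A⟩).2 v w
      = A ((trivializationAt E (TangentSpace I) x₀).symmL ℝ x v)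
          ((trivializationAt E (TangentSpace I) x₀).symmL ℝ x w) := by
  rw [hom_trivializationAt_apply]
  simp only [ContinuousLinearMap.inCoordinates, ContinuousLinearMap.comp_apply]
  rw [Bundle.Trivialization.continuousLinearMapAt_apply, Bundle.Trivialization.linearMapAt_apply,
    if_pos ⟨hx, trivial⟩]
  exact trivializationAt_oneForm ..

theorem baseSet_mem_nhds (x₀ : M) :
    (trivializationAt E (TangentSpace I) x₀).baseSet ∈ nhds x₀ :=
  (trivializationAt E (TangentSpace I) x₀).open_baseSet.mem_nhds
    (FiberBundle.mem_baseSet_trivializationAt' x₀)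

theorem contMDiff_tensor (α β : OneForm I M) :
    ContMDiff I (I.prod 𝓘(ℝ, E →L[ℝ] E →L[ℝ] ℝ)) ∞
      (fun x ↦ Bundle.TotalSpace.mk' (E →L[ℝ] E →L[ℝ] ℝ)
        (E := fun x : M ↦ TangentSpace I x →L[ℝ] TangentSpace I x →L[ℝ] ℝ) x
        (tensor (α x) (β x))) := by
  intro x₀
  have hα := α.contMDiff x₀
  have hβ := β.contMDiff x₀
  rw [Bundle.contMDiffAt_section] at hα hβ ⊢
  have key : ContDiff ℝ ∞ (fun p : (E →L[ℝ] ℝ) × (E →L[ℝ] ℝ) ↦ p.1.smulRight p.2) := by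
    fun_prop
  refine (key.contMDiff.contMDiffAt.comp x₀ (hα.prodMk_space hβ)).congr_of_eventuallyEq ?_
  filter_upwards [baseSet_mem_nhds (I := I) x₀] with x hx
  ext v w
  rw [trivializationAt_twoTensor _ _ hx]
  simp [trivializationAt_oneForm, tensor]

theorem mdifferentiableAt_oneForm_apply (α : OneForm I M) {x : M}
    {Y : ∀ x : M, TangentSpace I x} (hY : MDiffAt (T% Y) x) :
    MDiffAt (fun y ↦ α y (Y y)) x := by
  have : MDifferentiableAt I (I.prod 𝓘(ℝ, ℝ))
      (fun y ↦ Bundle.TotalSpace.mk' ℝ (E := Bundle.Trivial M ℝ) y (α y (Y y))) x :=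
    MDifferentiableAt.clm_bundle_apply (F₁ := E) (F₂ := ℝ) (E₂ := Bundle.Trivial M ℝ)
      α.mdifferentiableAt hY
  simp only [mdifferentiableAt_totalSpace] at this
  exact this.2

theorem mdifferentiableAt_metric_apply (h : Metric I M) {x : M}
    {Y Z : ∀ x : M, TangentSpace I x} (hY : MDiffAt (T% Y) x) (hZ : MDiffAt (T% Z) x) :
    MDiffAt (fun y ↦ h.inner y (Y y) (Z y)) x := by
  have : MDifferentiableAt I (I.prod 𝓘(ℝ, ℝ))
      (fun y ↦ Bundle.TotalSpace.mk' ℝ (E := Bundle.Trivial M ℝ) y (h.inner y (Y y) (Z y))) x :=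
    MDifferentiableAt.clm_bundle_apply₂ (F₁ := E) (F₂ := E) (F₃ := ℝ) (E₃ := Bundle.Trivial M ℝ)
      (h.contMDiff.mdifferentiable (by simp) x) hY hZ
  simp only [mdifferentiableAt_totalSpace] at this
  exact this.2

theorem metric_injective (h : Metric I M) (x : M) : Function.Injective (h.inner x) := by
  rw [injective_iff_map_eq_zero]
  intro v hv
  by_contra hne
  have := h.pos x v hne
  simp [hv] at this

theorem covDeriv_tensorial_left (cov : CovariantDerivative I E (TangentSpace I : M → Type _))
    (α : OneForm I M) (x : M) (Y : ∀ x : M, TangentSpace I x) :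
    TensorialAt I E (fun X : ∀ x : M, TangentSpace I x ↦
      d% (fun y ↦ α y (Y y)) x (X x) - α x (cov Y x (X x))) x where
  smul {f X} hf hX := by
    simp
    ring
  add {X X'} hX hX' := by
    simp
    ring

theorem covDeriv_tensorial_right (cov : CovariantDerivative I E (TangentSpace I : M → Type _))
    (α : OneForm I M) (x : M) (X : ∀ x : M, TangentSpace I x) :
    TensorialAt I E (fun Y : ∀ x : M, TangentSpace I x ↦
      d% (fun y ↦ α y (Y y)) x (X x) - α x (cov Y x (X x))) x where
  smul {f Y} hf hY := by
    have : (fun y ↦ α y ((f • Y) y)) = fun y ↦ f y * α y (Y y) := by ext; simp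
    rw [this, mvfderiv_fun_mul hf (mdifferentiableAt_oneForm_apply α hY),
      cov.isCovariantDerivativeOn.leibniz hY hf]
    simp
    ring
  add {Y Y'} hY hY' := by
    have : (fun y ↦ α y ((Y + Y') y)) = fun y ↦ α y (Y y) + α y (Y' y) := by ext; simp
    rw [this, mvfderiv_fun_add (mdifferentiableAt_oneForm_apply α hY)
      (mdifferentiableAt_oneForm_apply α hY'), cov.isCovariantDerivativeOn.add hY hY']
    simp
    ring

variable (I M) in
/-- The space of exact one-forms: the differentials of smooth functions. -/
def exactOneForms : Submodule ℝ (OneForm I M) where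
  carrier := {α | ∃ f : M → ℝ, ContMDiff I 𝓘(ℝ, ℝ) ∞ f ∧ ∀ x, α x = d% f x}
  add_mem' := by
    rintro α β ⟨f, hf, hα⟩ ⟨g, hg, hβ⟩
    refine ⟨fun x ↦ f x + g x, hf.add hg, fun x ↦ ?_⟩
    rw [mvfderiv_fun_add (hf.mdifferentiable (by simp) x) (hg.mdifferentiable (by simp) x),
      ← hα, ← hβ]
    rfl
  zero_mem' := ⟨fun _ ↦ 0, contMDiff_const, fun x ↦ by rw [mvfderiv_const]; rfl⟩
  smul_mem' := by
    rintro c α ⟨f, hf, hα⟩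
    refine ⟨fun x ↦ c * f x, contMDiff_const.mul hf, fun x ↦ ?_⟩
    rw [mvfderiv_fun_mul mdifferentiableAt_const (hf.mdifferentiable (by simp) x), ← hα,
      mvfderiv_const]
    ext v
    simp

variable [FiniteDimensional ℝ E]

/-! ### Exterior derivative of one-forms and the first de Rham cohomology -/

/-- The expression `X(α(Y)) - Y(α(X)) - α([X, Y])` at the point `x`. -/
def extDerivAux (α : OneForm I M) (x : M) (X Y : ∀ x : M, TangentSpace I x) : ℝ :=
  d% (fun y ↦ α y (Y y)) x (X x) - d% (fun y ↦ α y (X y)) x (Y x)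
    - α x (VectorField.mlieBracket I X Y x)

theorem extDerivAux_tensorial_left (α : OneForm I M) (x : M) (Y : ∀ x : M, TangentSpace I x) :
    TensorialAt I E (extDerivAux α x · Y) x where
  smul {f X} hf hX := by
    have : (fun y ↦ α y ((f • X) y)) = fun y ↦ f y * α y (X y) := by ext; simp
    simp only [extDerivAux]
    rw [this, mvfderiv_fun_mul hf (mdifferentiableAt_oneForm_apply α hX),
      VectorField.mlieBracket_smul_left hf hX]
    simp
    ring
  add {X X'} hX hX' := by
    have : (fun y ↦ α y ((X + X') y)) = fun y ↦ α y (X y) + α y (X' y) := by ext; simp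
    simp only [extDerivAux]
    rw [this, mvfderiv_fun_add (mdifferentiableAt_oneForm_apply α hX)
      (mdifferentiableAt_oneForm_apply α hX'), VectorField.mlieBracket_add_left hX hX']
    simp
    ring

theorem extDerivAux_tensorial_right (α : OneForm I M) (x : M) (X : ∀ x : M, TangentSpace I x) :
    TensorialAt I E (extDerivAux α x X ·) x where
  smul {f Y} hf hY := by
    have : (fun y ↦ α y ((f • Y) y)) = fun y ↦ f y * α y (Y y) := by ext; simp
    simp only [extDerivAux]
    rw [this, mvfderiv_fun_mul hf (mdifferentiableAt_oneForm_apply α hY),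
      VectorField.mlieBracket_smul_right hf hY]
    simp
    ring
  add {Y Y'} hY hY' := by
    have : (fun y ↦ α y ((Y + Y') y)) = fun y ↦ α y (Y y) + α y (Y' y) := by ext; simp
    simp only [extDerivAux]
    rw [this, mvfderiv_fun_add (mdifferentiableAt_oneForm_apply α hY)
      (mdifferentiableAt_oneForm_apply α hY'), VectorField.mlieBracket_add_right hY hY']
    simp
    ring

/-- The exterior derivative of a one-form: the tensor `dα` with
`dα(X, Y) = X(α(Y)) - Y(α(X)) - α([X, Y])`. -/
def extDeriv (α : OneForm I M) (x : M) : TangentSpace I x →L[ℝ] TangentSpace I x →L[ℝ] ℝ :=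
  TensorialAt.mkHom₂ (extDerivAux α x) x (fun Y _ ↦ extDerivAux_tensorial_left α x Y)
    (fun X _ ↦ extDerivAux_tensorial_right α x X)

theorem extDeriv_apply (α : OneForm I M) {x : M} {X Y : ∀ x : M, TangentSpace I x}
    (hX : MDiffAt (T% X) x) (hY : MDiffAt (T% Y) x) :
    extDeriv α x (X x) (Y x) = d% (fun y ↦ α y (Y y)) x (X x) - d% (fun y ↦ α y (X y)) x (Y x)
      - α x (VectorField.mlieBracket I X Y x) :=
  TensorialAt.mkHom₂_apply _ _ hX hY

theorem extDeriv_add (α β : OneForm I M) (x : M) :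
    extDeriv (α + β) x = extDeriv α x + extDeriv β x := by
  ext v w
  have e (Y : ∀ x : M, TangentSpace I x) :
      (fun y ↦ (α + β) y (Y y)) = fun y ↦ α y (Y y) + β y (Y y) := by ext; simp
  have hd (v : TangentSpace I x) : MDiffAt (T% (FiberBundle.extend E v)) x :=
    FiberBundle.mdifferentiableAt_extend I E v
  simp only [add_apply, extDeriv, TensorialAt.mkHom₂_apply_eq_extend,
    extDerivAux]
  rw [e, e, mvfderiv_fun_add (mdifferentiableAt_oneForm_apply α (hd v))
    (mdifferentiableAt_oneForm_apply β (hd v)),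
    mvfderiv_fun_add (mdifferentiableAt_oneForm_apply α (hd w))
    (mdifferentiableAt_oneForm_apply β (hd w))]
  simp
  ring

theorem extDeriv_smul (c : ℝ) (α : OneForm I M) (x : M) :
    extDeriv (c • α) x = c • extDeriv α x := by
  ext v w
  have e (Y : ∀ x : M, TangentSpace I x) :
      (fun y ↦ (c • α) y (Y y)) = fun y ↦ c * α y (Y y) := by ext; simp
  have hd (v : TangentSpace I x) : MDiffAt (T% (FiberBundle.extend E v)) x :=
    FiberBundle.mdifferentiableAt_extend I E v
  simp only [smul_apply, extDeriv, TensorialAt.mkHom₂_apply_eq_extend,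
    extDerivAux]
  rw [e, e, mvfderiv_fun_mul mdifferentiableAt_const (mdifferentiableAt_oneForm_apply α (hd v)),
    mvfderiv_fun_mul mdifferentiableAt_const (mdifferentiableAt_oneForm_apply α (hd w))]
  simp [mvfderiv_const]
  ring

variable (I M) in
/-- The space of closed one-forms. -/
def closedOneForms : Submodule ℝ (OneForm I M) where
  carrier := {α | ∀ x, extDeriv α x = 0}
  add_mem' {α β} hα hβ x := by
    ext v w
    simp [extDeriv_add, hα x, hβ x]
  zero_mem' x := by
    have := extDeriv_smul 0 (0 : OneForm I M) x
    have e : (0 : ℝ) • (0 : OneForm I M) = 0 := by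
      ext y v
      simp
    rw [e] at this
    refine this.trans ?_
    ext v w
    simp
  smul_mem' c α hα x := by
    ext v w
    simp [extDeriv_smul, hα x]

variable (I M) in
/-- The first de Rham cohomology `H¹(M, ℝ)`: closed one-forms modulo exact one-forms. -/
abbrev DeRhamH1 := closedOneForms I M ⧸ (exactOneForms I M).submoduleOf (closedOneForms I M)

/-- The condition `[α] = 0 ∈ H¹(M, ℝ)`: the one-form `α` is closed and its class vanishes. -/
def HasZeroClass (α : OneForm I M) : Prop :=
  ∃ hα : α ∈ closedOneForms I M, (Submodule.Quotient.mk ⟨α, hα⟩ : DeRhamH1 I M) = 0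

/-! ### Musical isomorphisms -/

/-- The musical isomorphism `v ↦ h(v, ·)` from tangent vectors to covectors. -/
def flat (h : Metric I M) (x : M) : TangentSpace I x ≃ₗ[ℝ] (TangentSpace I x →L[ℝ] ℝ) :=
  haveI : FiniteDimensional ℝ (TangentSpace I x) := inferInstanceAs (FiniteDimensional ℝ E)
  haveI : T2Space (TangentSpace I x) := inferInstanceAs (T2Space E)
  LinearMap.linearEquivOfInjective
    (h.inner x : TangentSpace I x →ₗ[ℝ] (TangentSpace I x →L[ℝ] ℝ))
    (metric_injective h x) (by
      rw [← (LinearMap.toContinuousLinearMap (𝕜 := ℝ) (E := TangentSpace I x)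
        (F' := ℝ)).finrank_eq]
      exact Subspace.dual_finrank_eq.symm)

theorem flat_apply (h : Metric I M) (x : M) (v : TangentSpace I x) :
    flat h x v = h.inner x v := rfl

/-- The metric dual `α ↦ α♯` of covectors. -/
def sharp (h : Metric I M) (x : M) (α : TangentSpace I x →L[ℝ] ℝ) : TangentSpace I x :=
  (flat h x).symm α

theorem metric_sharp (h : Metric I M) (x : M) (α : TangentSpace I x →L[ℝ] ℝ)
    (v : TangentSpace I x) : h.inner x (sharp h x α) v = α v := by
  rw [← flat_apply, sharp, LinearEquiv.apply_symm_apply]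

theorem contMDiff_apply_sharp (h : Metric I M) (T : TwoTensor I M) (α : OneForm I M) :
    ContMDiff I (I.prod 𝓘(ℝ, E →L[ℝ] ℝ)) ∞
      (fun x ↦ Bundle.TotalSpace.mk' (E →L[ℝ] ℝ)
        (E := fun x : M ↦ TangentSpace I x →L[ℝ] ℝ) x (T x (sharp h x (α x)))) := by
  have : CompleteSpace E := FiniteDimensional.complete ℝ E
  intro x₀
  have hα := α.contMDiff x₀
  have hT := T.contMDiff x₀
  have hh := h.contMDiff x₀
  rw [Bundle.contMDiffAt_section] at hα hT hh ⊢
  set G : M → (E →L[ℝ] E →L[ℝ] ℝ) := fun x ↦ (trivializationAt (E →L[ℝ] E →L[ℝ] ℝ)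
    (fun x : M ↦ TangentSpace I x →L[ℝ] TangentSpace I x →L[ℝ] ℝ) x₀ ⟨x, h.inner x⟩).2 with hG
  have hGinj : ∀ x ∈ (trivializationAt E (TangentSpace I) x₀).baseSet,
      ∀ v, G x v = 0 → v = 0 := by
    intro x hx v hv
    have h1 : h.inner x ((trivializationAt E (TangentSpace I) x₀).symmL ℝ x v)
        ((trivializationAt E (TangentSpace I) x₀).symmL ℝ x v) = 0 := by
      rw [← trivializationAt_twoTensor x₀ x hx]
      change G x v v = 0
      simp [hv]
    have h2 : (trivializationAt E (TangentSpace I) x₀).symmL ℝ x v = 0 := by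
      by_contra hne
      exact (h.pos x _ hne).ne' h1
    have h3 := (trivializationAt E (TangentSpace I) x₀).continuousLinearMapAt_symmL
      (R := ℝ) hx v
    rw [h2] at h3
    simpa using h3.symm
  have hGinv : ∀ x ∈ (trivializationAt E (TangentSpace I) x₀).baseSet,
      ∃ e : E ≃L[ℝ] (E →L[ℝ] ℝ), (e : E →L[ℝ] (E →L[ℝ] ℝ)) = G x := by
    intro x hx
    let e := LinearMap.linearEquivOfInjective (G x : E →ₗ[ℝ] (E →L[ℝ] ℝ))
      ((injective_iff_map_eq_zero (G x)).2 (hGinj x hx)) (by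
      rw [← (LinearMap.toContinuousLinearMap (𝕜 := ℝ) (E := E) (F' := ℝ)).finrank_eq]
      exact Subspace.dual_finrank_eq.symm)
    exact ⟨e.toContinuousLinearEquiv, by ext v w; rfl⟩
  have hx₀ := FiberBundle.mem_baseSet_trivializationAt' (F := E)
    (E := (TangentSpace I : M → Type _)) x₀
  obtain ⟨e₀, he₀⟩ := hGinv x₀ hx₀
  have hinv : ContMDiffAt I 𝓘(ℝ, (E →L[ℝ] ℝ) →L[ℝ] E) ∞ (fun x ↦ (G x).inverse) x₀ := by
    have := contDiffAt_map_inverse (n := ∞) e₀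
    rw [he₀] at this
    exact this.contMDiffAt.comp x₀ hh
  refine (hT.clm_apply (hinv.clm_apply hα)).congr_of_eventuallyEq ?_
  filter_upwards [baseSet_mem_nhds (I := I) x₀] with x hx
  obtain ⟨e, he⟩ := hGinv x hx
  have hs : (G x).inverse ((trivializationAt (E →L[ℝ] ℝ)
        (fun x : M ↦ TangentSpace I x →L[ℝ] ℝ) x₀ ⟨x, α x⟩).2)
      = (trivializationAt E (TangentSpace I) x₀).continuousLinearMapAt ℝ x
        (sharp h x (α x)) := by
    rw [← he, ContinuousLinearMap.inverse_equiv]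
    change e.symm _ = _
    rw [ContinuousLinearEquiv.symm_apply_eq]
    ext w
    have : (e : E →L[ℝ] (E →L[ℝ] ℝ)) ((trivializationAt E (TangentSpace I)
        x₀).continuousLinearMapAt ℝ x (sharp h x (α x))) w
        = α x ((trivializationAt E (TangentSpace I) x₀).symmL ℝ x w) := by
      rw [he, hG]
      simp only
      rw [trivializationAt_twoTensor x₀ x hx,
        Bundle.Trivialization.symmL_continuousLinearMapAt _ hx, metric_sharp]
    rw [trivializationAt_oneForm]
    exact this.symm
  ext w
  rw [hs, trivializationAt_oneForm, trivializationAt_twoTensor _ _ hx,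
    Bundle.Trivialization.symmL_continuousLinearMapAt _ hx]

/-- The one-form `Θ(α) = Θ(α♯, ·)`, the evaluation of a two-tensor on the metric dual of `α`. -/
def applyForm (h : Metric I M) (Θ : TwoTensor I M) (α : OneForm I M) : OneForm I M where
  toFun x := Θ x (sharp h x (α x))
  contMDiff_toFun := contMDiff_apply_sharp h Θ α

/-! ### The Levi-Civita connection -/

/-- A connection on the tangent bundle is a Levi-Civita connection of `h` if it is torsion-free
and compatible with `h`, that is, `d(h(Y, Z)) = h(∇ Y, Z) + h(Y, ∇ Z)`. -/
structure IsLeviCivita (h : Metric I M)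
    (cov : CovariantDerivative I E (TangentSpace I : M → Type _)) : Prop where
  torsion_eq_zero : cov.torsion = 0
  metric_compatible : ∀ {x : M} {Y Z : ∀ x : M, TangentSpace I x},
    MDiffAt (T% Y) x → MDiffAt (T% Z) x → ∀ v : TangentSpace I x,
      d% (fun y ↦ h.inner y (Y y) (Z y)) x v
        = h.inner x (cov Y x v) (Z x) + h.inner x (Y x) (cov Z x v)

/-- The right-hand side of the Koszul formula for `2 h(∇_X Y, Z)`. -/
def koszul (h : Metric I M) (x : M) (X Y Z : ∀ x : M, TangentSpace I x) : ℝ :=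
  d% (fun y ↦ h.inner y (Y y) (Z y)) x (X x) + d% (fun y ↦ h.inner y (X y) (Z y)) x (Y x)
    - d% (fun y ↦ h.inner y (X y) (Y y)) x (Z x)
    + h.inner x (VectorField.mlieBracket I X Y x) (Z x)
    - h.inner x (VectorField.mlieBracket I X Z x) (Y x)
    - h.inner x (VectorField.mlieBracket I Y Z x) (X x)

section Koszul

variable (h : Metric I M) {x : M} {X X' Y Y' Z Z' : ∀ x : M, TangentSpace I x} {f : M → ℝ}

theorem mvfderiv_metric_smul_left (hf : MDiffAt f x) (hY : MDiffAt (T% Y) x)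
    (hZ : MDiffAt (T% Z) x) (v : TangentSpace I x) :
    d% (fun y ↦ h.inner y ((f • Y) y) (Z y)) x v
      = f x * d% (fun y ↦ h.inner y (Y y) (Z y)) x v + d% f x v * h.inner x (Y x) (Z x) := by
  have : (fun y ↦ h.inner y ((f • Y) y) (Z y)) = fun y ↦ f y * h.inner y (Y y) (Z y) := by
    ext; simp
  rw [this, mvfderiv_fun_mul hf (mdifferentiableAt_metric_apply h hY hZ)]
  simp
  ring

theorem mvfderiv_metric_smul_right (hf : MDiffAt f x) (hY : MDiffAt (T% Y) x)
    (hZ : MDiffAt (T% Z) x) (v : TangentSpace I x) :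
    d% (fun y ↦ h.inner y (Y y) ((f • Z) y)) x v
      = f x * d% (fun y ↦ h.inner y (Y y) (Z y)) x v + d% f x v * h.inner x (Y x) (Z x) := by
  have : (fun y ↦ h.inner y (Y y) ((f • Z) y)) = fun y ↦ f y * h.inner y (Y y) (Z y) := by
    ext; simp
  rw [this, mvfderiv_fun_mul hf (mdifferentiableAt_metric_apply h hY hZ)]
  simp
  ring

theorem mvfderiv_metric_add_left (hY : MDiffAt (T% Y) x) (hY' : MDiffAt (T% Y') x)
    (hZ : MDiffAt (T% Z) x) (v : TangentSpace I x) :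
    d% (fun y ↦ h.inner y ((Y + Y') y) (Z y)) x v
      = d% (fun y ↦ h.inner y (Y y) (Z y)) x v + d% (fun y ↦ h.inner y (Y' y) (Z y)) x v := by
  have : (fun y ↦ h.inner y ((Y + Y') y) (Z y))
      = fun y ↦ h.inner y (Y y) (Z y) + h.inner y (Y' y) (Z y) := by
    ext; simp
  rw [this, mvfderiv_fun_add (mdifferentiableAt_metric_apply h hY hZ)
    (mdifferentiableAt_metric_apply h hY' hZ)]
  simp

theorem mvfderiv_metric_add_right (hY : MDiffAt (T% Y) x) (hZ : MDiffAt (T% Z) x)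
    (hZ' : MDiffAt (T% Z') x) (v : TangentSpace I x) :
    d% (fun y ↦ h.inner y (Y y) ((Z + Z') y)) x v
      = d% (fun y ↦ h.inner y (Y y) (Z y)) x v + d% (fun y ↦ h.inner y (Y y) (Z' y)) x v := by
  have : (fun y ↦ h.inner y (Y y) ((Z + Z') y))
      = fun y ↦ h.inner y (Y y) (Z y) + h.inner y (Y y) (Z' y) := by
    ext; simp
  rw [this, mvfderiv_fun_add (mdifferentiableAt_metric_apply h hY hZ)
    (mdifferentiableAt_metric_apply h hY hZ')]
  simp

theorem koszul_tensorial_left (hY : MDiffAt (T% Y) x) (hZ : MDiffAt (T% Z) x) :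
    TensorialAt I E (koszul h x · Y Z) x where
  smul {f X} hf hX := by
    simp only [koszul]
    rw [mvfderiv_metric_smul_left h hf hX hZ, mvfderiv_metric_smul_left h hf hX hY,
      VectorField.mlieBracket_smul_left hf hX, VectorField.mlieBracket_smul_left hf hX]
    simp
    ring
  add {X X'} hX hX' := by
    simp only [koszul]
    rw [mvfderiv_metric_add_left h hX hX' hZ, mvfderiv_metric_add_left h hX hX' hY,
      VectorField.mlieBracket_add_left hX hX', VectorField.mlieBracket_add_left hX hX']
    simp
    ring

theorem koszul_tensorial_right (hX : MDiffAt (T% X) x) (hY : MDiffAt (T% Y) x) :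
    TensorialAt I E (koszul h x X Y ·) x where
  smul {f Z} hf hZ := by
    simp only [koszul]
    rw [mvfderiv_metric_smul_right h hf hX hZ, mvfderiv_metric_smul_right h hf hY hZ,
      VectorField.mlieBracket_smul_right hf hZ, VectorField.mlieBracket_smul_right hf hZ]
    simp
    rw [h.symm x (Z x) (X x), h.symm x (Z x) (Y x)]
    ring
  add {Z Z'} hZ hZ' := by
    simp only [koszul]
    rw [mvfderiv_metric_add_right h hX hZ hZ', mvfderiv_metric_add_right h hY hZ hZ',
      VectorField.mlieBracket_add_right hZ hZ', VectorField.mlieBracket_add_right hZ hZ']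
    simp
    ring

theorem koszul_smul_middle (hf : MDiffAt f x) (hX : MDiffAt (T% X) x) (hY : MDiffAt (T% Y) x)
    (hZ : MDiffAt (T% Z) x) :
    koszul h x X (f • Y) Z = f x * koszul h x X Y Z
      + 2 * (d% f x (X x) * h.inner x (Y x) (Z x)) := by
  simp only [koszul]
  rw [mvfderiv_metric_smul_left h hf hY hZ, mvfderiv_metric_smul_right h hf hX hY,
    VectorField.mlieBracket_smul_right hf hY, VectorField.mlieBracket_smul_left hf hY]
  simp
  rw [h.symm x (Y x) (X x)]
  ring

theorem koszul_add_middle (hX : MDiffAt (T% X) x) (hY : MDiffAt (T% Y) x)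
    (hY' : MDiffAt (T% Y') x) (hZ : MDiffAt (T% Z) x) :
    koszul h x X (Y + Y') Z = koszul h x X Y Z + koszul h x X Y' Z := by
  simp only [koszul]
  rw [mvfderiv_metric_add_left h hY hY' hZ, mvfderiv_metric_add_right h hX hY hY',
    VectorField.mlieBracket_add_right hY hY', VectorField.mlieBracket_add_left hY hY']
  simp
  ring

open scoped Classical in
/-- The connection defined by the Koszul formula. -/
def koszulConnection (Y : ∀ x : M, TangentSpace I x) (x : M) :
    TangentSpace I x →L[ℝ] TangentSpace I x :=
  if hY : MDiffAt (T% Y) x then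
    haveI : FiniteDimensional ℝ (TangentSpace I x) := inferInstanceAs (FiniteDimensional ℝ E)
    haveI : T2Space (TangentSpace I x) := inferInstanceAs (T2Space E)
    LinearMap.toContinuousLinearMap ((flat h x).symm.toLinearMap ∘ₗ
      ((2⁻¹ : ℝ) • TensorialAt.mkHom₂ (koszul h x · Y ·) x
        (fun _ hZ ↦ koszul_tensorial_left h hY hZ)
        (fun _ hX ↦ koszul_tensorial_right h hX hY) :
          TangentSpace I x →L[ℝ] TangentSpace I x →L[ℝ] ℝ).toLinearMap)
  else 0

theorem metric_koszulConnection (hX : MDiffAt (T% X) x) (hY : MDiffAt (T% Y) x)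
    (hZ : MDiffAt (T% Z) x) :
    2 * h.inner x (koszulConnection h Y x (X x)) (Z x) = koszul h x X Y Z := by
  rw [← TensorialAt.mkHom₂_apply (Φ := (koszul h x · Y ·))
    (fun _ hZ ↦ koszul_tensorial_left h hY hZ) (fun _ hX ↦ koszul_tensorial_right h hX hY) hX hZ,
    ← flat_apply]
  simp [koszulConnection, hY]

theorem exists_mdifferentiableAt_eq (v : TangentSpace I x) :
    ∃ X : ∀ x : M, TangentSpace I x, MDiffAt (T% X) x ∧ X x = v :=
  ⟨FiberBundle.extend E v, FiberBundle.mdifferentiableAt_extend I E v, by simp⟩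

theorem eq_of_metric_eq {v w : TangentSpace I x}
    (H : ∀ z : TangentSpace I x, h.inner x v z = h.inner x w z) : v = w :=
  metric_injective h x (ContinuousLinearMap.ext H)

theorem isCovariantDerivativeOn_koszulConnection :
    IsCovariantDerivativeOn (I := I) (M := M) E (koszulConnection h) Set.univ where
  add {Y Y' x} hY hY' _ := by
    ext v
    refine eq_of_metric_eq h fun z ↦ ?_
    obtain ⟨X, hX, rfl⟩ := exists_mdifferentiableAt_eq v
    obtain ⟨Z, hZ, rfl⟩ := exists_mdifferentiableAt_eq z
    have h1 := metric_koszulConnection h hX (mdifferentiableAt_add_section hY hY') hZ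
    have h2 := metric_koszulConnection h hX hY hZ
    have h3 := metric_koszulConnection h hX hY' hZ
    rw [koszul_add_middle h hX hY hY' hZ] at h1
    simp only [add_apply, map_add]
    linarith
  leibniz {Y f x} hY hf _ := by
    ext v
    refine eq_of_metric_eq h fun z ↦ ?_
    obtain ⟨X, hX, rfl⟩ := exists_mdifferentiableAt_eq v
    obtain ⟨Z, hZ, rfl⟩ := exists_mdifferentiableAt_eq z
    have h1 := metric_koszulConnection h hX (hf.smul_section hY) hZ
    have h2 := metric_koszulConnection h hX hY hZ
    rw [koszul_smul_middle h hf hX hY hZ, ← h2] at h1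
    simp only [add_apply, map_add, smul_apply, map_smul,
      ContinuousLinearMap.smulRight_apply, smul_eq_mul]
    linarith

theorem exists_isLeviCivita :
    ∃ cov : CovariantDerivative I E (TangentSpace I : M → Type _), IsLeviCivita h cov := by
  refine ⟨⟨koszulConnection h, isCovariantDerivativeOn_koszulConnection h⟩, ?_, ?_⟩
  · rw [CovariantDerivative.torsion_eq_zero_iff]
    intro X Y x hX hY
    refine eq_of_metric_eq h fun z ↦ ?_
    obtain ⟨Z, hZ, rfl⟩ := exists_mdifferentiableAt_eq z
    have h1 := metric_koszulConnection h hX hY hZ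
    have h2 := metric_koszulConnection h hY hX hZ
    have e : (fun y ↦ h.inner y (X y) (Y y)) = fun y ↦ h.inner y (Y y) (X y) := by
      ext y; exact h.symm y _ _
    simp only [koszul] at h1 h2
    rw [VectorField.mlieBracket_swap_apply (V := Y) (W := X)] at h2
    rw [e] at h1
    simp only [map_neg, neg_apply, map_sub,
      sub_apply] at h2 ⊢
    linarith
  · intro x Y Z hY hZ v
    obtain ⟨X, hX, rfl⟩ := exists_mdifferentiableAt_eq v
    have h1 := metric_koszulConnection h hX hY hZ
    have h2 := metric_koszulConnection h hX hZ hY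
    have e : (fun y ↦ h.inner y (Z y) (Y y)) = fun y ↦ h.inner y (Y y) (Z y) := by
      ext y; exact h.symm y _ _
    simp only [koszul] at h1 h2
    rw [VectorField.mlieBracket_swap_apply (V := Z) (W := Y), e] at h2
    rw [h.symm x (Y x)]
    simp only [map_neg, neg_apply] at h2 ⊢
    linarith

end Koszul

/-- The Levi-Civita connection `∇^h` of a Riemannian metric. -/
def leviCivita (h : Metric I M) : CovariantDerivative I E (TangentSpace I : M → Type _) :=
  (exists_isLeviCivita h).choose

theorem isLeviCivita_leviCivita (h : Metric I M) : IsLeviCivita h (leviCivita h) :=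
  (exists_isLeviCivita h).choose_spec

/-- The covariant derivative of a one-form, with the direction of differentiation in the first
slot: `(∇α)(X, Y) = (∇_X α)(Y) = X(α(Y)) - α(∇_X Y)`. -/
def covDeriv (cov : CovariantDerivative I E (TangentSpace I : M → Type _)) (α : OneForm I M)
    (x : M) : TangentSpace I x →L[ℝ] TangentSpace I x →L[ℝ] ℝ :=
  TensorialAt.mkHom₂ (fun X Y : ∀ x : M, TangentSpace I x ↦
      d% (fun y ↦ α y (Y y)) x (X x) - α x (cov Y x (X x))) x
    (fun Y _ ↦ covDeriv_tensorial_left cov α x Y) (fun X _ ↦ covDeriv_tensorial_right cov α x X)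

theorem covDeriv_apply (cov : CovariantDerivative I E (TangentSpace I : M → Type _))
    (α : OneForm I M) {x : M} {X Y : ∀ x : M, TangentSpace I x}
    (hX : MDiffAt (T% X) x) (hY : MDiffAt (T% Y) x) :
    covDeriv cov α x (X x) (Y x) = d% (fun y ↦ α y (Y y)) x (X x) - α x (cov Y x (X x)) :=
  TensorialAt.mkHom₂_apply (Φ := fun X Y : ∀ x : M, TangentSpace I x ↦
      d% (fun y ↦ α y (Y y)) x (X x) - α x (cov Y x (X x))) _ _ hX hY

/-- The constraint equations for a Riemannian metric `h`, a two-tensor `Θ` and one-forms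
`eᵤ`, `eₗ`: `∇^h eᵤ + Θ = Θ(eᵤ) ⊗ eᵤ`, `∇^h eₗ = Θ(eₗ) ⊗ eᵤ` and `[Θ(eᵤ)] = 0`. -/
structure ConstraintEquations (h : Metric I M) (Θ : TwoTensor I M) (eᵤ eₗ : OneForm I M) :
    Prop where
  nabla_u : ∀ x, covDeriv (leviCivita h) eᵤ x + Θ x = tensor (applyForm h Θ eᵤ x) (eᵤ x)
  nabla_l : ∀ x, covDeriv (leviCivita h) eₗ x = tensor (applyForm h Θ eₗ x) (eᵤ x)
  zero_class : HasZeroClass (applyForm h Θ eᵤ)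

end General

/-! ### Coframes on three-manifolds -/

section Coframe

variable (S : Type*) [TopologicalSpace S] [ChartedSpace (EuclideanSpace ℝ (Fin 3)) S]
  [IsManifold (𝓡 3) ∞ S]

/-- A global smooth coframe `(eᵤ, eₗ, eₙ)` on a three-manifold. -/
structure Coframe where
  u : OneForm (𝓡 3) S
  l : OneForm (𝓡 3) S
  n : OneForm (𝓡 3) S
  linearIndependent : ∀ x, LinearIndependent ℝ ![u x, l x, n x]

variable {S}

theorem Coframe.eq_zero (e : Coframe S) (x : S) (v : TangentSpace (𝓡 3) x)
    (hu : e.u x v = 0) (hl : e.l x v = 0) (hn : e.n x v = 0) : v = 0 := by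
  have : FiniteDimensional ℝ (TangentSpace (𝓡 3) x) :=
    inferInstanceAs (FiniteDimensional ℝ (EuclideanSpace ℝ (Fin 3)))
  have : T2Space (TangentSpace (𝓡 3) x) :=
    inferInstanceAs (T2Space (EuclideanSpace ℝ (Fin 3)))
  have hdim : Module.finrank ℝ (TangentSpace (𝓡 3) x) = 3 :=
    finrank_euclideanSpace_fin (𝕜 := ℝ) (n := 3)
  have hdim' : Module.finrank ℝ (TangentSpace (𝓡 3) x →L[ℝ] ℝ) = 3 := by
    rw [← (LinearMap.toContinuousLinearMap (𝕜 := ℝ) (E := TangentSpace (𝓡 3) x)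
        (F' := ℝ)).finrank_eq]
    exact Subspace.dual_finrank_eq.trans hdim
  have hspan := (e.linearIndependent x).span_eq_top_of_card_eq_finrank' (by simp [hdim'])
  have key : ∀ φ : TangentSpace (𝓡 3) x →L[ℝ] ℝ, φ v = 0 := by
    intro φ
    have hφ : φ ∈ Submodule.span ℝ (Set.range ![e.u x, e.l x, e.n x]) := by
      rw [hspan]; trivial
    induction hφ using Submodule.span_induction with
    | mem ψ hψ =>
      obtain ⟨i, rfl⟩ := hψ
      fin_cases i <;> simp [hu, hl, hn]
    | zero => simp
    | add a b _ _ ha hb => simp [ha, hb]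
    | smul c a _ ha => simp [ha]
  exact (Module.forall_dual_apply_eq_zero_iff ℝ v).1 fun φ ↦
    key (LinearMap.toContinuousLinearMap φ)

/-- The Riemannian metric `h = eᵤ ⊗ eᵤ + eₗ ⊗ eₗ + eₙ ⊗ eₙ` of a coframe. -/
def Coframe.metric (e : Coframe S) : Metric (𝓡 3) S where
  inner x := tensor (e.u x) (e.u x) + tensor (e.l x) (e.l x) + tensor (e.n x) (e.n x)
  symm x v w := by
    simp [tensor]
    ring
  pos x v hv := by
    have h0 : ¬ (e.u x v = 0 ∧ e.l x v = 0 ∧ e.n x v = 0) :=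
      fun ⟨hu, hl, hn⟩ ↦ hv (e.eq_zero x v hu hl hn)
    simp only [tensor, add_apply, ContinuousLinearMap.smulRight_apply,
      smul_apply, smul_eq_mul]
    by_contra hle
    push Not at hle
    have := mul_self_nonneg (e.u x v)
    have := mul_self_nonneg (e.l x v)
    have := mul_self_nonneg (e.n x v)
    exact h0 ⟨mul_self_eq_zero.1 (by linarith), mul_self_eq_zero.1 (by linarith),
      mul_self_eq_zero.1 (by linarith)⟩
  isVonNBounded x := by
    have : FiniteDimensional ℝ (TangentSpace (𝓡 3) x) :=
      inferInstanceAs (FiniteDimensional ℝ (EuclideanSpace ℝ (Fin 3)))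
    have : T2Space (TangentSpace (𝓡 3) x) :=
      inferInstanceAs (T2Space (EuclideanSpace ℝ (Fin 3)))
    let φ : TangentSpace (𝓡 3) x →ₗ[ℝ] (Fin 3 → ℝ) :=
      LinearMap.pi ![(e.u x).toLinearMap, (e.l x).toLinearMap, (e.n x).toLinearMap]
    have hφ : Function.Injective φ := by
      rw [injective_iff_map_eq_zero]
      intro v hv
      exact e.eq_zero x v (congrFun hv 0) (congrFun hv 1) (congrFun hv 2)
    let ψ : TangentSpace (𝓡 3) x ≃L[ℝ] (Fin 3 → ℝ) :=
      (LinearMap.linearEquivOfInjective φ hφ (by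
        rw [Module.finrank_fin_fun]
        exact finrank_euclideanSpace_fin (𝕜 := ℝ) (n := 3))).toContinuousLinearEquiv
    have hb := (NormedSpace.isVonNBounded_closedBall ℝ (Fin 3 → ℝ) 1).image
      (ψ.symm : (Fin 3 → ℝ) →L[ℝ] TangentSpace (𝓡 3) x)
    refine hb.subset ?_
    intro v hv
    refine ⟨ψ v, ?_, ψ.symm_apply_apply v⟩
    simp only [tensor, add_apply, ContinuousLinearMap.smulRight_apply,
      smul_apply, smul_eq_mul, Set.mem_ofPred_eq] at hv
    have := mul_self_nonneg (e.u x v)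
    have := mul_self_nonneg (e.l x v)
    have := mul_self_nonneg (e.n x v)
    rw [mem_closedBall_zero_iff, pi_norm_le_iff_of_nonneg zero_le_one]
    intro i
    rw [Real.norm_eq_abs]
    refine abs_le_one_iff_mul_self_le_one.2 ?_
    fin_cases i
    · change e.u x v * e.u x v ≤ 1
      linarith
    · change e.l x v * e.l x v ≤ 1
      linarith
    · change e.n x v * e.n x v ≤ 1
      linarith
  contMDiff := ((contMDiff_tensor e.u e.u).add_section (contMDiff_tensor e.l e.l)).add_section
    (contMDiff_tensor e.n e.n)

/-- The exterior differential system for a pair `(e, Θ)`, where `h` is the metric of the coframe: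
`de_a = Θ(e_a) ∧ eᵤ` for `a = u, l, n`, and `[Θ(eᵤ)] = 0`. -/
structure ParallelCauchySystem (e : Coframe S) (Θ : TwoTensor (𝓡 3) S) : Prop where
  d_u : ∀ x, extDeriv e.u x = wedge (applyForm e.metric Θ e.u x) (e.u x)
  d_l : ∀ x, extDeriv e.l x = wedge (applyForm e.metric Θ e.l x) (e.u x)
  d_n : ∀ x, extDeriv e.n x = wedge (applyForm e.metric Θ e.n x) (e.u x)
  zero_class : HasZeroClass (applyForm e.metric Θ e.u)

end Coframe

end CauchyGeometry

end

/-!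
Metric compatibility makes the covariant derivatives `∇ eₐ` of an orthonormal coframe a skew family
of bilinear forms: `(∇_v eₐ)(E_b)` is skew in `a, b`. Vanishing torsion makes `deₐ` the
antisymmetrization of `∇ eₐ`. A skew family is determined by its antisymmetrizations, since a
three-index array symmetric in one pair of adjacent indices and skew in the outer pair vanishes; it
is also determined by all but one of its members. If `Θ` is symmetric, `Θ(eₐ) ⊗ eᵤ - δₐᵤ Θ` is a
skew family with antisymmetrizations `Θ(eₐ) ∧ eᵤ`. Hence the equations for `deᵤ`, `deₗ`, `deₙ` say
that `∇ eₐ` is this family, and so do the constraint equations, which omit only `eₙ`. Conversely the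
skewness of `∇ eₐ` turns the constraint equations into the symmetry of `Θ`.
-/

noncomputable section

namespace CauchyGeometry

section FrameAlgebra

variable {ι 𝕜 V : Type*} [NormedField 𝕜] [AddCommGroup V] [Module 𝕜 V] [TopologicalSpace V]
  {E : ι → V} {A B : ι → V →L[𝕜] V →L[𝕜] 𝕜}

theorem eq_zero_of_symm_of_skew {G : Type*} [AddCommGroup G] [IsAddTorsionFree G]
    {T : ι → ι → ι → G} (hsymm : ∀ a b c, T a b c = T a c b) (hskew : ∀ a b c, T a b c = -T c b a)
    (a b c : ι) : T a b c = 0 := by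
  have hneg : T a b c = -T a b c :=
    calc T a b c = -T c b a := hskew a b c
      _ = -T c a b := by rw [hsymm c b a]
      _ = T b a c := by rw [hskew c a b, neg_neg]
      _ = T b c a := hsymm b a c
      _ = -T a c b := hskew b c a
      _ = -T a b c := by rw [hsymm a c b]
  exact self_eq_neg.1 hneg

theorem bilinear_ext_of_span_eq_top (hE : Submodule.span 𝕜 (Set.range E) = ⊤)
    {S T : V →L[𝕜] V →L[𝕜] 𝕜} (h : ∀ a b, S (E a) (E b) = T (E a) (E b)) : S = T := by
  refine ContinuousLinearMap.coe_injective (LinearMap.ext_on_range hE fun a ↦ ?_)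
  exact ContinuousLinearMap.coe_injective (LinearMap.ext_on_range hE fun b ↦ h a b)

theorem bilinear_symm_of_span_eq_top (hE : Submodule.span 𝕜 (Set.range E) = ⊤)
    {T : V →L[𝕜] V →L[𝕜] 𝕜} (h : ∀ a b, T (E a) (E b) = T (E b) (E a)) (v w : V) :
    T v w = T w v := by
  have hflip : T.toLinearMap₁₂ = T.toLinearMap₁₂.flip :=
    LinearMap.ext_on_range hE fun a ↦ LinearMap.ext_on_range hE fun b ↦ h a b
  exact LinearMap.congr_fun₂ hflip v w

/-- A family `A a` of bilinear forms is skew with respect to a frame `E` if the covectors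
`A a · (E b)` form a skew-symmetric matrix. For the covariant derivatives `A a = ∇ eₐ` of an
orthonormal coframe this is the matrix of connection one-forms. -/
def IsSkewFamily (E : ι → V) (A : ι → V →L[𝕜] V →L[𝕜] 𝕜) : Prop :=
  ∀ a b v, A a v (E b) = -A b v (E a)

theorem IsSkewFamily.sub (hA : IsSkewFamily E A) (hB : IsSkewFamily E B) :
    IsSkewFamily E (A - B) := by
  intro a b v
  simp only [Pi.sub_apply, sub_apply, hA a b v, hB a b v]
  ring

theorem IsSkewFamily.eq_of_sub_swap_eq [CharZero 𝕜] (hE : Submodule.span 𝕜 (Set.range E) = ⊤)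
    (hA : IsSkewFamily E A) (hB : IsSkewFamily E B)
    (h : ∀ a v w, A a v w - A a w v = B a v w - B a w v) : A = B := by
  let T (a b c : ι) : 𝕜 := (A - B) a (E b) (E c)
  have hT : ∀ a b c, T a b c = 0 := by
    refine eq_zero_of_symm_of_skew (fun a b c ↦ ?_) fun a b c ↦ hA.sub hB a c (E b)
    simp only [T, Pi.sub_apply, sub_apply]
    linear_combination h a (E b) (E c)
  exact funext fun a ↦ bilinear_ext_of_span_eq_top hE fun b c ↦ sub_eq_zero.1 (hT a b c)

theorem IsSkewFamily.eq_of_forall_ne_eq [CharZero 𝕜] (hE : Submodule.span 𝕜 (Set.range E) = ⊤)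
    (hA : IsSkewFamily E A) (hB : IsSkewFamily E B) (n : ι) (h : ∀ a ≠ n, A a = B a) :
    A = B := by
  funext a
  refine bilinear_ext_of_span_eq_top hE fun c b ↦ ?_
  rcases ne_or_eq a n with ha | rfl
  · rw [h a ha]
  rcases ne_or_eq b a with hb | rfl
  · rw [hA, hB, h b hb]
  · rw [CharZero.eq_neg_self_iff.1 (hA b b (E c)), CharZero.eq_neg_self_iff.1 (hB b b (E c))]

variable [DecidableEq ι] {Θ : V →L[𝕜] V →L[𝕜] 𝕜} {η : V →L[𝕜] 𝕜} {u n : ι}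

/-- The values of `∇ eₐ` prescribed by the constraint equations, for `Θ(eₐ) = Θ(Eₐ, ·)` and
`η = eᵤ`: `Θ(eₐ) ⊗ eᵤ` for `a ≠ u`, and `Θ(eᵤ) ⊗ eᵤ - Θ` for `a = u`. -/
def constraintFamily (E : ι → V) (Θ : V →L[𝕜] V →L[𝕜] 𝕜) (η : V →L[𝕜] 𝕜) (u a : ι) :
    V →L[𝕜] V →L[𝕜] 𝕜 :=
  (Θ (E a)).smulRight η - if a = u then Θ else 0

theorem constraintFamily_apply (a : ι) (v w : V) :
    constraintFamily E Θ η u a v w = Θ (E a) v * η w - if a = u then Θ v w else 0 := by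
  unfold constraintFamily
  split_ifs <;> simp

theorem isSkewFamily_constraintFamily (hη : ∀ b, η (E b) = if b = u then 1 else 0)
    (hΘ : ∀ v w, Θ v w = Θ w v) : IsSkewFamily E (constraintFamily E Θ η u) := by
  intro a b v
  simp only [constraintFamily_apply, hη, hΘ v, mul_ite, mul_one, mul_zero, neg_sub]

theorem constraintFamily_sub_swap (hΘ : ∀ v w, Θ v w = Θ w v) (a : ι) (v w : V) :
    constraintFamily E Θ η u a v w - constraintFamily E Θ η u a w v
      = Θ (E a) v * η w - Θ (E a) w * η v := by
  simp only [constraintFamily_apply, hΘ w v]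
  ring

theorem IsSkewFamily.symm_of_eq_constraintFamily [CharZero 𝕜]
    (hE : Submodule.span 𝕜 (Set.range E) = ⊤) (hη : ∀ b, η (E b) = if b = u then 1 else 0)
    (hA : IsSkewFamily E A) (hun : u ≠ n)
    (h : ∀ a ≠ n, A a = constraintFamily E Θ η u a) (v w : V) : Θ v w = Θ w v := by
  have hΘ (b : ι) (hb : b ≠ n) (v : V) : Θ (E b) v = Θ v (E b) := by
    have huv := hA u b v
    rw [h u hun, h b hb, constraintFamily_apply, constraintFamily_apply, hη, hη, if_pos rfl,
      if_pos rfl] at huv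
    rcases eq_or_ne b u with rfl | hbu
    · rw [if_pos rfl, if_pos rfl] at huv
      linear_combination (1 / 2) * huv
    · rw [if_neg hbu, if_neg hbu] at huv
      linear_combination huv
  refine bilinear_symm_of_span_eq_top hE (fun a b ↦ ?_) v w
  rcases ne_or_eq a n with ha | rfl
  · exact hΘ a ha (E b)
  rcases ne_or_eq b a with hb | rfl
  · exact (hΘ b hb (E a)).symm
  · rfl

theorem IsSkewFamily.forall_ne_eq_constraintFamily_iff [CharZero 𝕜]
    (hE : Submodule.span 𝕜 (Set.range E) = ⊤) (hη : ∀ b, η (E b) = if b = u then 1 else 0)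
    (hA : IsSkewFamily E A) (hun : u ≠ n) :
    (∀ a ≠ n, A a = constraintFamily E Θ η u a) ↔ (∀ v w, Θ v w = Θ w v) ∧
      ∀ a v w, A a v w - A a w v = Θ (E a) v * η w - Θ (E a) w * η v := by
  constructor
  · intro h
    have hΘ := hA.symm_of_eq_constraintFamily hE hη hun h
    have hAll := hA.eq_of_forall_ne_eq hE (isSkewFamily_constraintFamily hη hΘ) n h
    exact ⟨hΘ, fun a v w ↦ by rw [hAll, constraintFamily_sub_swap hΘ]⟩
  · rintro ⟨hΘ, h⟩ a -
    refine congrFun (hA.eq_of_sub_swap_eq hE (isSkewFamily_constraintFamily hη hΘ) ?_) a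
    intro a v w
    rw [h, constraintFamily_sub_swap hΘ]

end FrameAlgebra

section Connection

variable {E : Type*} [NormedAddCommGroup E] [NormedSpace ℝ E] {H : Type*} [TopologicalSpace H]
  {I : ModelWithCorners ℝ E H} {M : Type*} [TopologicalSpace M] [ChartedSpace H M] {x : M}

theorem mdifferentiableAt_fun_sum {ι : Type*} {s : Finset ι} {f : ι → M → ℝ}
    (hf : ∀ i ∈ s, MDiffAt (f i) x) : MDiffAt (fun y ↦ ∑ i ∈ s, f i y) x := by
  classical
  induction s using Finset.induction_on with
  | empty => simpa using mdifferentiableAt_const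
  | insert i s hi ih =>
    simp only [Finset.sum_insert hi]
    exact (hf i (Finset.mem_insert_self i s)).add
      (ih fun j hj ↦ hf j (Finset.mem_insert_of_mem hj))

theorem mvfderiv_fun_sum {ι : Type*} {s : Finset ι} {f : ι → M → ℝ}
    (hf : ∀ i ∈ s, MDiffAt (f i) x) : d% (fun y ↦ ∑ i ∈ s, f i y) x = ∑ i ∈ s, d% (f i) x := by
  classical
  induction s using Finset.induction_on with
  | empty => simpa using mvfderiv_const (0 : ℝ)
  | insert i s hi ih =>
    rw [Finset.forall_mem_insert] at hf
    simp only [Finset.sum_insert hi]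
    rw [mvfderiv_fun_add hf.1 (mdifferentiableAt_fun_sum hf.2), ih hf.2]

theorem tensor_apply (α β : TangentSpace I x →L[ℝ] ℝ) (v w : TangentSpace I x) :
    tensor α β v w = α v * β w := by
  simp [tensor]

theorem wedge_apply (α β : TangentSpace I x →L[ℝ] ℝ) (v w : TangentSpace I x) :
    wedge α β v w = α v * β w - α w * β v := by
  simp [wedge, tensor_apply, mul_comm]

variable [IsManifold I ∞ M] {h : Metric I M}

/-- A family of one-forms is an orthonormal coframe of the metric `h` if it is linearly independent
at every point and `h = ∑ₐ eₐ ⊗ eₐ`. -/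
structure IsOrthonormalCoframe {ι : Type*} [Fintype ι] (h : Metric I M) (e : ι → OneForm I M) :
    Prop where
  linearIndependent : ∀ x, LinearIndependent ℝ fun a ↦ e a x
  inner_eq_sum : ∀ x, h.inner x = ∑ a, tensor (e a x) (e a x)

theorem IsOrthonormalCoframe.inner_apply {ι : Type*} [Fintype ι] {e : ι → OneForm I M}
    (he : IsOrthonormalCoframe h e) (x : M) (v w : TangentSpace I x) :
    h.inner x v w = ∑ a, e a x v * e a x w := by
  simp [he.inner_eq_sum, tensor_apply]

variable [FiniteDimensional ℝ E]
  {cov : CovariantDerivative I E (TangentSpace I : M → Type _)}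

theorem covDeriv_sub_swap_of_torsion_eq_zero (hcov : cov.torsion = 0) (α : OneForm I M)
    (v w : TangentSpace I x) :
    covDeriv cov α x v w - covDeriv cov α x w v = extDeriv α x v w := by
  obtain ⟨X, hX, rfl⟩ := exists_mdifferentiableAt_eq v
  obtain ⟨Y, hY, rfl⟩ := exists_mdifferentiableAt_eq w
  rw [extDeriv_apply α hX hY, covDeriv_apply cov α hX hY, covDeriv_apply cov α hY hX,
    ← (cov.torsion_eq_zero_iff).1 hcov hX hY, map_sub]
  ring

/-- A connection on the tangent bundle is compatible with the metric `h`: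
`d(h(Y, Z)) = h(∇ Y, Z) + h(Y, ∇ Z)`. -/
def IsMetricCompatible (h : Metric I M)
    (cov : CovariantDerivative I E (TangentSpace I : M → Type _)) : Prop :=
  ∀ ⦃x : M⦄ ⦃Y Z : ∀ x : M, TangentSpace I x⦄, MDiffAt (T% Y) x → MDiffAt (T% Z) x →
    ∀ v : TangentSpace I x, d% (fun y ↦ h.inner y (Y y) (Z y)) x v
      = h.inner x (cov Y x v) (Z x) + h.inner x (Y x) (cov Z x v)

theorem IsLeviCivita.isMetricCompatible (hcov : IsLeviCivita h cov) : IsMetricCompatible h cov :=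
  fun _ _ _ ↦ hcov.metric_compatible

/-- The frame of tangent vectors `Eₐ = eₐ♯` at `x`, dual to the one-forms `eₐ` when these form an
orthonormal coframe. -/
def dualFrame {ι : Type*} (h : Metric I M) (e : ι → OneForm I M) (x : M) (a : ι) :
    TangentSpace I x :=
  sharp h x (e a x)

namespace IsOrthonormalCoframe

variable {ι : Type*} [Fintype ι] {e : ι → OneForm I M} (he : IsOrthonormalCoframe h e)
include he

theorem apply_dualFrame [DecidableEq ι] (a b : ι) :
    e a x (dualFrame h e x b) = if a = b then 1 else 0 := by
  refine (he.linearIndependent x).eq_coords_of_eq (f := fun c ↦ e c x (dualFrame h e x b))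
    (g := fun c ↦ if c = b then 1 else 0) ?_ a
  ext v
  calc (∑ c, e c x (dualFrame h e x b) • e c x) v
      = h.inner x (dualFrame h e x b) v := by simp [he.inner_apply]
    _ = e b x v := metric_sharp h x (e b x) v
    _ = (∑ c, (if c = b then 1 else 0 : ℝ) • e c x) v := by simp

theorem sum_smul_dualFrame (v : TangentSpace I x) : ∑ a, e a x v • dualFrame h e x a = v := by
  classical
  refine eq_of_metric_eq h fun w ↦ ?_
  simp [he.inner_apply, he.apply_dualFrame]

theorem span_dualFrame (x : M) : Submodule.span ℝ (Set.range (dualFrame h e x)) = ⊤ := by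
  refine eq_top_iff.2 fun v _ ↦ ?_
  rw [← he.sum_smul_dualFrame v]
  exact Submodule.sum_mem _ fun a _ ↦
    Submodule.smul_mem _ _ (Submodule.subset_span (Set.mem_range_self a))

theorem sum_covDeriv_mul_add_mul_covDeriv (hcov : IsMetricCompatible h cov)
    (v y z : TangentSpace I x) :
    ∑ c, (covDeriv cov (e c) x v y * e c x z + e c x y * covDeriv cov (e c) x v z) = 0 := by
  obtain ⟨X, hX, rfl⟩ := exists_mdifferentiableAt_eq v
  obtain ⟨Y, hY, rfl⟩ := exists_mdifferentiableAt_eq y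
  obtain ⟨Z, hZ, rfl⟩ := exists_mdifferentiableAt_eq z
  have hdY (c : ι) := mdifferentiableAt_oneForm_apply (e c) hY
  have hdZ (c : ι) := mdifferentiableAt_oneForm_apply (e c) hZ
  have hleibniz : d% (fun y ↦ h.inner y (Y y) (Z y)) x (X x)
      = ∑ c, (e c x (Y x) * d% (fun y ↦ e c y (Z y)) x (X x)
        + e c x (Z x) * d% (fun y ↦ e c y (Y y)) x (X x)) := by
    simp only [he.inner_apply]
    have hmul (c : ι) : MDiffAt (fun y ↦ e c y (Y y) * e c y (Z y)) x := (hdY c).mul (hdZ c)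
    rw [mvfderiv_fun_sum fun c _ ↦ hmul c]
    simp [mvfderiv_fun_mul (hdY _) (hdZ _)]
  have hcompat := hcov hY hZ (X x)
  rw [hleibniz, he.inner_apply, he.inner_apply, ← Finset.sum_add_distrib, ← sub_eq_zero,
    ← Finset.sum_sub_distrib] at hcompat
  simp only [covDeriv_apply cov _ hX hY, covDeriv_apply cov _ hX hZ]
  rw [← hcompat]
  exact Finset.sum_congr rfl fun c _ ↦ by ring

theorem isSkewFamily_covDeriv (hcov : IsMetricCompatible h cov) (x : M) :
    IsSkewFamily (dualFrame h e x) fun a ↦ covDeriv cov (e a) x := by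
  classical
  intro a b v
  have hsum := he.sum_covDeriv_mul_add_mul_covDeriv hcov v (dualFrame h e x b) (dualFrame h e x a)
  simp only [he.apply_dualFrame, Finset.sum_add_distrib, mul_ite, ite_mul, mul_one, one_mul,
    mul_zero, zero_mul, Finset.sum_ite_eq', Finset.mem_univ, if_true] at hsum
  exact eq_neg_of_add_eq_zero_left hsum

theorem forall_ne_covDeriv_eq_iff [DecidableEq ι] (hcov : IsLeviCivita h cov) (Θ : TwoTensor I M)
    {u n : ι} (hun : u ≠ n) (x : M) :
    (∀ a ≠ n, covDeriv cov (e a) x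
        = tensor (applyForm h Θ (e a) x) (e u x) - if a = u then Θ x else 0) ↔
      (∀ v w, Θ x v w = Θ x w v) ∧
        ∀ a, extDeriv (e a) x = wedge (applyForm h Θ (e a) x) (e u x) := by
  have hη (b : ι) : e u x (dualFrame h e x b) = if b = u then 1 else 0 := by
    simp only [he.apply_dualFrame, eq_comm]
  refine ((he.isSkewFamily_covDeriv hcov.isMetricCompatible x).forall_ne_eq_constraintFamily_iff
    (he.span_dualFrame x) hη hun).trans (and_congr_right fun _ ↦ forall_congr' fun a ↦ ?_)
  simp only [covDeriv_sub_swap_of_torsion_eq_zero hcov.torsion_eq_zero, ContinuousLinearMap.ext_iff,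
    wedge_apply]
  rfl

end IsOrthonormalCoframe

end Connection

section Coframe

variable {S : Type*} [TopologicalSpace S] [ChartedSpace (EuclideanSpace ℝ (Fin 3)) S]
  [IsManifold (𝓡 3) ∞ S]

theorem Coframe.isOrthonormalCoframe (e : Coframe S) :
    IsOrthonormalCoframe e.metric ![e.u, e.l, e.n] where
  linearIndependent x := by
    convert e.linearIndependent x using 1
    funext a
    fin_cases a <;> rfl
  inner_eq_sum x := by
    simp [Fin.sum_univ_three, Coframe.metric]

theorem Coframe.covDeriv_eq_iff (e : Coframe S) (Θ : TwoTensor (𝓡 3) S) (x : S) :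
    (covDeriv (leviCivita e.metric) e.u x + Θ x = tensor (applyForm e.metric Θ e.u x) (e.u x) ∧
        covDeriv (leviCivita e.metric) e.l x = tensor (applyForm e.metric Θ e.l x) (e.u x)) ↔
      (∀ v w, Θ x v w = Θ x w v) ∧
        extDeriv e.u x = wedge (applyForm e.metric Θ e.u x) (e.u x) ∧
        extDeriv e.l x = wedge (applyForm e.metric Θ e.l x) (e.u x) ∧
        extDeriv e.n x = wedge (applyForm e.metric Θ e.n x) (e.u x) := by
  have hiff := e.isOrthonormalCoframe.forall_ne_covDeriv_eq_iff
    (isLeviCivita_leviCivita e.metric) Θ (show (0 : Fin 3) ≠ 2 by decide) x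
  simpa [Fin.forall_fin_succ, ContinuousLinearMap.ext_iff, eq_sub_iff_add_eq] using hiff

end Coframe

end CauchyGeometry

end

theorem mainTheorem6_general {S : Type*} [TopologicalSpace S]
    [ChartedSpace (EuclideanSpace ℝ (Fin 3)) S] [IsManifold (𝓡 3) ∞ S]
    (e : CauchyGeometry.Coframe S) (Θ : CauchyGeometry.TwoTensor (𝓡 3) S) :
    CauchyGeometry.ConstraintEquations e.metric Θ e.u e.l ↔
      (∀ (x : S) (v w : TangentSpace (𝓡 3) x), Θ x v w = Θ x w v) ∧
        CauchyGeometry.ParallelCauchySystem e Θ := by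
  constructor
  · rintro ⟨hu, hl, hclass⟩
    have hx (x : S) := (e.covDeriv_eq_iff Θ x).1 ⟨hu x, hl x⟩
    exact ⟨fun x ↦ (hx x).1, fun x ↦ (hx x).2.1, fun x ↦ (hx x).2.2.1, fun x ↦ (hx x).2.2.2, hclass⟩
  · rintro ⟨hΘ, hu, hl, hn, hclass⟩
    have hx (x : S) := (e.covDeriv_eq_iff Θ x).2 ⟨hΘ x, hu x, hl x, hn x⟩
    exact ⟨fun x ↦ (hx x).1, fun x ↦ (hx x).2, hclass⟩

/-- On a smooth three-manifold `S` with a global coframe `e = (eᵤ, eₗ, eₙ)`, its metric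
`h = eᵤ ⊗ eᵤ + eₗ ⊗ eₗ + eₙ ⊗ eₙ` and a symmetric two-tensor `Θ`, the constraint equations are
equivalent to the exterior differential system. -/
theorem mainTheorem6 {S : Type*} [TopologicalSpace S]
    [ChartedSpace (EuclideanSpace ℝ (Fin 3)) S] [IsManifold (𝓡 3) ∞ S]
    (e : CauchyGeometry.Coframe S) (Θ : CauchyGeometry.TwoTensor (𝓡 3) S)
    (hΘ : ∀ (x : S) (v w : TangentSpace (𝓡 3) x), Θ x v w = Θ x w v) :
    CauchyGeometry.ConstraintEquations e.metric Θ e.u e.l ↔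
      CauchyGeometry.ParallelCauchySystem e Θ :=
  (mainTheorem6_general e Θ).trans (and_iff_right hΘ)
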